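/- Let $\phi:[0,\infty)\to(0,\infty)$ be continuous with $\phi\in L^2(0,\infty)$ and $\phi\in W^{1,2}_{\rm loc}[0,\infty)$; the latter means that there is a function $g$, square integrable on $[0,a]$ for every $a>0$, with $\phi(x)=\phi(0)+\int_0^x g(s)\,ds$ for all $x\ge 0$. Put $$\psi(x)=\phi(x)\int_0^x\frac{ds}{\phi(s)^2}\quad(x\ge0),\qquad G(x,y)=\begin{cases}\psi(x)\phi(y)&\text{if }0\le x\le y,\\ \phi(x)\psi(y)&\text{if }0\le y\le x,\end{cases}$$ and assume that $G(\cdot,\cdot)$ is the integral kernel of a bounded operator $G$ on the complex Hilbert space $L^2(0,\infty)$. For $\gamma\in\mathbb C\setminus\{0\}$ put $\xi=\psi+\gamma\phi$ and $$G_\gamma(x,y)=\begin{cases}\xi(x)\phi(y)&\text{if }0\le x\le y,\\ \phi(x)\xi(y)&\text{if }0\le y\le x.\end{cases}$$ Then for every $\gamma\in\mathbb C\setminus\{0\}$ the function $G_\gamma(\cdot,\cdot)$ is the integral kernel of a bounded operator $G_\gamma$ on $L^2(0,\infty)$, namely $G_\gamma=G+\gamma\,|\phi\rangle\langle\phi|$,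 where $|\phi\rangle\langle\phi|f=\langle \phi,f\rangle\phi$ with $\langle\phi,f\rangle=\int_0^\infty\phi f\,dx$. Moreover $\operatorname{Ker}(G_\gamma)=\{0\}$ and $\operatorname{Ran}(G_\gamma)$ is dense. The operator $H_\gamma=G_\gamma^{-1}$, with domain $\operatorname{Ran}(G_\gamma)$, is closed and densely defined, and $0\notin\operatorname{Spec}(H_\gamma)$. The essential spectrum of $H_\gamma$, that is, the set of $z\in\mathbb C$ for which $z-H_\gamma$ is not a Fredholm operator from $\operatorname{Dom}(H_\gamma)$ with its graph norm to $L^2(0,\infty)$, is the same for all $\gamma\in\mathbb C\setminus\{0\}$. If $\gamma\in\mathbb R\setminus\{0\}$ then $H_\gamma$ is self-adjoint. -/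

import Mathlib

open MeasureTheory

namespace HalfLine

/-- Lebesgue measure on the half-line `(0, ∞)`. -/
noncomputable abbrev μ : Measure ℝ := volume.restrict (Set.Ioi 0)

/-- The complex Hilbert space `L²(0, ∞)`. -/
abbrev L2 : Type := Lp ℂ 2 μ

/-- The class `W^{1,2}_loc[0,∞)`: continuous functions `f` on `[0,∞)` of the form
`f x = f 0 + ∫₀ˣ g` with `g` square integrable on every interval `[0,a]`. -/
def MemW (f : ℝ → ℝ) : Prop :=
  ContinuousOn f (Set.Ici 0) ∧
    ∃ g : ℝ → ℝ, (∀ a : ℝ, 0 ≤ a → MemLp g 2 (volume.restrict (Set.Icc 0 a))) ∧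
      ∀ x : ℝ, 0 ≤ x → f x = f 0 + ∫ s in (0 : ℝ)..x, g s

/-- `ψ x = φ x ∫₀ˣ ds / φ(s)²`. -/
noncomputable def psi (φ : ℝ → ℝ) (x : ℝ) : ℝ :=
  φ x * ∫ s in (0 : ℝ)..x, 1 / (φ s) ^ 2

/-- `ξ = ψ + γ φ`. -/
noncomputable def xi (φ : ℝ → ℝ) (γ : ℂ) (x : ℝ) : ℂ := (psi φ x : ℂ) + γ * (φ x : ℂ)

/-- The Green function of the Dirichlet problem:
`ψ x φ y` for `x ≤ y` and `φ x ψ y` for `y ≤ x`. -/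
noncomputable def green (φ : ℝ → ℝ) (x y : ℝ) : ℂ :=
  if x ≤ y then (psi φ x : ℂ) * (φ y : ℂ) else (φ x : ℂ) * (psi φ y : ℂ)

/-- The Green function of the Robin problem:
`ξ x φ y` for `x ≤ y` and `φ x ξ y` for `y ≤ x`. -/
noncomputable def greenRobin (φ : ℝ → ℝ) (γ : ℂ) (x y : ℝ) : ℂ :=
  if x ≤ y then xi φ γ x * (φ y : ℂ) else (φ x : ℂ) * xi φ γ y

/-- `K` is the integral kernel of the bounded operator `T` on `L²(0,∞)`: for every `f`, for almost
every `x > 0`, the integral `∫₀^∞ K x y f(y) dy` converges absolutely and equals `(T f)(x)`. -/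
def IsKernelOf (K : ℝ → ℝ → ℂ) (T : L2 →L[ℂ] L2) : Prop :=
  ∀ f : L2, ∀ᵐ x ∂μ, Integrable (fun y => K x y * f y) μ ∧ T f x = ∫ y, K x y * f y ∂μ

section Unbounded

variable {E : Type*} [NormedAddCommGroup E] [NormedSpace ℂ E]

/-- The inverse of a bounded operator `T`, as an unbounded operator with domain the range of `T`
(meaningful when `T` is injective). -/
noncomputable def inverseOp (T : E →L[ℂ] E) : E →ₗ.[ℂ] E :=
  ((T : E →ₗ[ℂ] E).toPMap ⊤).inverse

/-- The bounded operator `R` is a two-sided inverse of `z - A : Dom A → E`. -/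
def IsResolvent (A : E →ₗ.[ℂ] E) (z : ℂ) (R : E →L[ℂ] E) : Prop :=
  (∀ x : A.domain, R (z • (x : E) - A x) = x) ∧
    ∀ y : E, ∃ x : A.domain, (x : E) = R y ∧ z • (x : E) - A x = y

/-- The spectrum of an unbounded operator: the `z` for which `z - A` has no bounded inverse. -/
def spec (A : E →ₗ.[ℂ] E) : Set ℂ := {z | ¬ ∃ R : E →L[ℂ] E, IsResolvent A z R}

/-- The operator `z - A`, as a bounded operator on `Dom A` with its graph norm; `Dom A` with the
graph norm is realised as the graph of `A`, a subspace of `E × E`. -/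
noncomputable def shift (A : E →ₗ.[ℂ] E) (z : ℂ) : A.graph →L[ℂ] E :=
  (z • ContinuousLinearMap.fst ℂ E E - ContinuousLinearMap.snd ℂ E E).comp A.graph.subtypeL

/-- The essential spectrum of a closed operator `A`: the `z` for which `z - A` is not a Fredholm
operator from `Dom A`, with its graph norm, to `E`. -/
def essSpec (A : E →ₗ.[ℂ] E) : Set ℂ := {z | ¬ (shift A z).IsFredholm}

end Unbounded

end HalfLine

namespace HalfLine

/-! ### Inverses of injective bounded operators: closedness, spectrum, Fredholm properties. -/

section Unbounded

variable {E : Type*} [NormedAddCommGroup E] [NormedSpace ℂ E]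

/-! The kernel factors as `φ x * (γ + ∫₀^{min x y} φ⁻²) * φ y`. If `G_γ f = 0`, cancel `φ x` and put
`h = φ f`, which is integrable. Fubini and differentiation in `x` force `∫₀ˣ h` to be constant, so
`h = 0` and `f = 0` (`ae_eq_zero_of_integral_primitive_min_eq_zero`). This works for every complex
`γ`.

`G` is self-adjoint because its kernel is symmetric and nonnegative (`IsKernelOf.isSelfAdjoint`).
Hence the adjoint of `G_γ` is `G` plus `conj γ` times the same rank one operator, again injective,
and `G_γ` has dense range.

The graph of `T⁻¹` consists of the pairs `(T b, b)`. This gives closedness, turns `z - T⁻¹` into the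
bounded operator `z T - 1`, and transfers self-adjointness from `T`. The operators `G_γ` differ by
finite rank, which preserves the Fredholm property. -/

theorem ker_toPMap_top_eq_bot {T : E →L[ℂ] E} (hT : ∀ f, T f = 0 → f = 0) :
    LinearMap.ker ((T : E →ₗ[ℂ] E).toPMap ⊤).toFun = ⊥ := by
  rw [LinearMap.ker_eq_bot']
  rintro ⟨m, hm⟩ h
  exact Subtype.ext (hT m h)

theorem mem_graph_inverseOp {T : E →L[ℂ] E} (hT : ∀ f, T f = 0 → f = 0) (p : E × E) :
    p ∈ (inverseOp T).graph ↔ T p.2 = p.1 := by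
  rw [inverseOp, LinearPMap.inverse_graph (ker_toPMap_top_eq_bot hT)]
  obtain ⟨a, b⟩ := p
  simp [LinearPMap.mem_graph_iff]

theorem mem_domain_inverseOp {T : E →L[ℂ] E} (hT : ∀ f, T f = 0 → f = 0) (x : E) :
    x ∈ (inverseOp T).domain ↔ x ∈ Set.range T := by
  rw [LinearPMap.mem_domain_iff]
  simp [mem_graph_inverseOp hT]

theorem apply_inverseOp {T : E →L[ℂ] E} (hT : ∀ f, T f = 0 → f = 0)
    (x : (inverseOp T).domain) : T (inverseOp T x) = x :=
  (mem_graph_inverseOp hT _).1 ((inverseOp T).mem_graph x)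

theorem isClosed_inverseOp {T : E →L[ℂ] E} (hT : ∀ f, T f = 0 → f = 0) :
    (inverseOp T).IsClosed := by
  have : ((inverseOp T).graph : Set (E × E)) = {p | T p.2 = p.1} := by
    ext p
    exact mem_graph_inverseOp hT p
  rw [LinearPMap.IsClosed, this]
  exact isClosed_eq (by fun_prop) (by fun_prop)

theorem dense_domain_inverseOp {T : E →L[ℂ] E} (hT : ∀ f, T f = 0 → f = 0)
    (hd : DenseRange T) : Dense ((inverseOp T).domain : Set E) := by
  have : ((inverseOp T).domain : Set E) = Set.range T := by
    ext x
    exact mem_domain_inverseOp hT x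
  rw [this]
  exact hd

theorem zero_notMem_spec_inverseOp {T : E →L[ℂ] E} (hT : ∀ f, T f = 0 → f = 0) :
    (0 : ℂ) ∉ spec (inverseOp T) := by
  simp only [spec, Set.mem_ofPred_eq, not_not]
  refine ⟨-T, fun x => by simp [apply_inverseOp hT], fun y => ?_⟩
  have hy : (T (-y), -y) ∈ (inverseOp T).graph := (mem_graph_inverseOp hT _).2 rfl
  obtain ⟨x, hx, hx'⟩ := (LinearPMap.mem_graph_iff _).1 hy
  exact ⟨x, by simpa using hx, by simp [hx']⟩

/-- The parametrisation `b ↦ (T b, b)` of the graph of `T⁻¹`. -/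
noncomputable def graphEquiv {T : E →L[ℂ] E} (hT : ∀ f, T f = 0 → f = 0) :
    E ≃L[ℂ] (inverseOp T).graph :=
  ContinuousLinearEquiv.equivOfInverse
    ((T.prod (ContinuousLinearMap.id ℂ E)).codRestrict (inverseOp T).graph
      fun _ => (mem_graph_inverseOp hT _).2 rfl)
    ((ContinuousLinearMap.snd ℂ E E).comp (inverseOp T).graph.subtypeL)
    (fun _ => rfl)
    (fun p => Subtype.ext (Prod.ext ((mem_graph_inverseOp hT _).1 p.2) rfl))

/-- Reduces the Fredholm property of the unbounded `z - T⁻¹` to that of a bounded operator on `E`.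
-/
theorem shift_comp_graphEquiv {T : E →L[ℂ] E} (hT : ∀ f, T f = 0 → f = 0) (z : ℂ) :
    (shift (inverseOp T) z).comp (graphEquiv hT : E →L[ℂ] (inverseOp T).graph) =
      z • T - ContinuousLinearMap.id ℂ E := by
  ext b
  rfl

theorem isFredholm_comp_equiv {F F' : Type*} [NormedAddCommGroup F] [NormedSpace ℂ F]
    [NormedAddCommGroup F'] [NormedSpace ℂ F'] (u : F →L[ℂ] F') (e : E ≃L[ℂ] F)
    (hu : u.IsFredholm) : (u.comp (e : E →L[ℂ] F)).IsFredholm := by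
  obtain ⟨v, hv⟩ := hu.exists_isQuasiInverse
  refine .of_isQuasiInverse (v := (e.symm : F →L[ℂ] E).comp v) ?_
  exact (e.toLinearEquiv.isQuasiInverse).comp hv

theorem isFredholm_shift_inverseOp_iff {T : E →L[ℂ] E} (hT : ∀ f, T f = 0 → f = 0) (z : ℂ) :
    (shift (inverseOp T) z).IsFredholm ↔ (z • T - ContinuousLinearMap.id ℂ E).IsFredholm := by
  rw [← shift_comp_graphEquiv hT]
  refine ⟨isFredholm_comp_equiv _ _, fun h => ?_⟩
  have hc : ((shift (inverseOp T) z).comp (graphEquiv hT : E →L[ℂ] (inverseOp T).graph)).comp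
      ((graphEquiv hT).symm : (inverseOp T).graph →L[ℂ] E) = shift (inverseOp T) z := by
    ext x
    simp
  exact hc ▸ isFredholm_comp_equiv _ (graphEquiv hT).symm h

-- An inverse modulo finite rank operators remains one after a finite rank perturbation.
open LinearMap.FiniteRangeSetoid in
theorem isFredholm_of_hasFiniteRange_sub {F : Type*} [NormedAddCommGroup F] [NormedSpace ℂ F]
    {u v : E →L[ℂ] F}
    (huv : ((v : E →ₗ[ℂ] F) - (u : E →ₗ[ℂ] F)).HasFiniteRange) (hu : u.IsFredholm) :
    v.IsFredholm := by
  obtain ⟨w, hw⟩ := hu.exists_isQuasiInverse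
  exact .of_isQuasiInverse (hw.congr (Setoid.refl _) (equiv_iff_hasFiniteRange.2 huv))

/-- Operators with a finite rank difference have inverses with the same essential spectrum. -/
theorem essSpec_inverseOp_eq {T S : E →L[ℂ] E} (hT : ∀ f, T f = 0 → f = 0)
    (hS : ∀ f, S f = 0 → f = 0)
    (h : ((T : E →ₗ[ℂ] E) - (S : E →ₗ[ℂ] E)).HasFiniteRange) :
    essSpec (inverseOp T) = essSpec (inverseOp S) := by
  ext z
  simp only [essSpec, Set.mem_ofPred_eq, isFredholm_shift_inverseOp_iff hT,
    isFredholm_shift_inverseOp_iff hS]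
  refine not_congr ⟨isFredholm_of_hasFiniteRange_sub ?_, isFredholm_of_hasFiniteRange_sub ?_⟩
  · have e : ((z • S - ContinuousLinearMap.id ℂ E : E →L[ℂ] E) : E →ₗ[ℂ] E) -
        ((z • T - ContinuousLinearMap.id ℂ E : E →L[ℂ] E) : E →ₗ[ℂ] E) =
        (-z) • ((T : E →ₗ[ℂ] E) - (S : E →ₗ[ℂ] E)) := by
      ext x
      simp [smul_sub]
      abel
    exact e ▸ h.smul (-z)
  · have e : ((z • T - ContinuousLinearMap.id ℂ E : E →L[ℂ] E) : E →ₗ[ℂ] E) -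
        ((z • S - ContinuousLinearMap.id ℂ E : E →L[ℂ] E) : E →ₗ[ℂ] E) =
        z • ((T : E →ₗ[ℂ] E) - (S : E →ₗ[ℂ] E)) := by
      ext x
      simp [smul_sub]
    exact e ▸ h.smul z

end Unbounded

/-! ### Self-adjoint inverses and dense ranges in Hilbert space. -/

section Hilbert

variable {E : Type*} [NormedAddCommGroup E] [InnerProductSpace ℂ E] [CompleteSpace E]

/-- Testing `p` against the graph vectors `(T b, b)` and moving `T` across the inner product gives
`p.1 - T p.2 ⊥ b` for all `b`, so the adjoint has the same graph. -/
theorem isSelfAdjoint_inverseOp {T : E →L[ℂ] E} (hT : ∀ f, T f = 0 → f = 0)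
    (hd : DenseRange T) (hs : IsSelfAdjoint T) : IsSelfAdjoint (inverseOp T) := by
  rw [LinearPMap.isSelfAdjoint_def]
  apply LinearPMap.eq_of_eq_graph
  rw [LinearPMap.adjoint_graph_eq_graph_adjoint (dense_domain_inverseOp hT hd)]
  have hsym : ∀ x y : E, inner ℂ (T x) y = inner ℂ x (T y) := fun x y => by
    rw [← ContinuousLinearMap.adjoint_inner_right, hs.adjoint_eq]
  ext p
  rw [Submodule.mem_adjoint_iff, mem_graph_inverseOp hT]
  constructor
  · intro h
    have key : ∀ b : E, inner ℂ b (p.1 - T p.2) = 0 := fun b => by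
      have := h (T b) b ((mem_graph_inverseOp hT _).2 rfl)
      rw [inner_sub_right, ← hsym]
      exact this
    exact (sub_eq_zero.1 (inner_self_eq_zero.1 (key _))).symm
  · intro h a b hab
    rw [mem_graph_inverseOp hT] at hab
    simp only at hab
    rw [← hab, hsym, h, sub_self]

theorem denseRange_of_adjoint_injective {T : E →L[ℂ] E}
    (h : ∀ f, ContinuousLinearMap.adjoint T f = 0 → f = 0) : DenseRange T := by
  have : (T.range)ᗮ = ⊥ := by
    rw [ContinuousLinearMap.orthogonal_range]
    exact LinearMap.ker_eq_bot'.2 h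
  have h2 := Submodule.topologicalClosure_eq_top_iff.2 this
  have h3 := Submodule.dense_iff_topologicalClosure_eq_top.2 h2
  rwa [LinearMap.coe_range] at h3

end Hilbert

/-! ### Injectivity for kernels that depend on `min x y`. -/

theorem setIntegral_Ici_eq_sub {H : ℝ → ℂ} (hH : Integrable H μ) {t : ℝ} (ht : 0 ≤ t) :
    ∫ y, (Set.Ici t).indicator H y ∂μ = (∫ y, H y ∂μ) - ∫ s in (0 : ℝ)..t, H s := by
  have hH' : IntegrableOn H (Set.Ioi 0) := hH
  have h1 : ∫ y, (Set.Ici t).indicator H y ∂μ = ∫ y in Set.Ioi t, H y := by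
    rw [setIntegral_indicator measurableSet_Ici,
      setIntegral_congr_set ((ae_eq_refl (Set.Ioi 0)).inter (Ioi_ae_eq_Ici (a := t)).symm),
      Set.Ioi_inter_Ioi, max_eq_right ht]
  have h2 : ∫ y, H y ∂μ = (∫ y in Set.Ioc 0 t, H y) + ∫ y in Set.Ioi t, H y := by
    rw [← setIntegral_union (Set.Ioc_disjoint_Ioi le_rfl) measurableSet_Ioi
      (hH'.mono_set Set.Ioc_subset_Ioi_self) (hH'.mono_set (Set.Ioi_subset_Ioi ht)),
      Set.Ioc_union_Ioi_eq_Ioi ht]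
  rw [h1, h2, intervalIntegral.integral_of_le ht, add_sub_cancel_left]

/-- Fubini's theorem on the triangle `0 < t ≤ min x y`. -/
theorem integral_primitive_min_mul {p : ℝ → ℂ} (hp : Continuous p) {H : ℝ → ℂ}
    (hH : Integrable H μ) {x : ℝ} (hx : 0 < x) :
    ∫ y, (∫ t in (0 : ℝ)..min x y, p t) * H y ∂μ =
      ∫ t in (0 : ℝ)..x, p t * ((∫ y, H y ∂μ) - ∫ s in (0 : ℝ)..t, H s) := by
  set ν : Measure ℝ := volume.restrict (Set.Ioc 0 x)
  have hpi : Integrable p ν := (hp.continuousOn.integrableOn_Icc).mono_set Set.Ioc_subset_Icc_self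
  let F : ℝ → ℝ → ℂ := fun y t => {q : ℝ × ℝ | q.2 ≤ q.1}.indicator (fun q => H q.1 * p q.2) (y, t)
  have hF : Integrable (Function.uncurry F) (μ.prod ν) :=
    (hH.mul_prod hpi).indicator (measurableSet_le measurable_snd measurable_fst)
  have hl : ∫ y, (∫ t in (0 : ℝ)..min x y, p t) * H y ∂μ = ∫ y, ∫ t, F y t ∂ν ∂μ := by
    refine integral_congr_ae ?_
    filter_upwards [ae_restrict_mem measurableSet_Ioi] with y hy
    have hy : 0 < y := hy
    have h1 : ∀ t, F y t = H y * (Set.Iic y).indicator p t := fun t => by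
      by_cases h : t ≤ y <;> simp [F, Set.indicator, h]
    simp only [h1]
    rw [integral_const_mul, mul_comm, setIntegral_indicator measurableSet_Iic,
      Set.Ioc_inter_Iic, intervalIntegral.integral_of_le (le_min hx.le hy.le)]
  rw [hl, integral_integral_swap hF, intervalIntegral.integral_of_le hx.le]
  refine setIntegral_congr_fun measurableSet_Ioc fun t ht => ?_
  have h1 : ∀ y, F y t = p t * (Set.Ici t).indicator H y := fun y => by
    by_cases h : t ≤ y <;> simp [F, Set.indicator, h, mul_comm]
  simp only [h1]
  rw [integral_const_mul, setIntegral_Ici_eq_sub hH ht.1.le]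

theorem ae_eq_zero_of_primitive_eq {H : ℝ → ℂ} (hH : Integrable H μ) {c : ℂ}
    (h : ∀ t : ℝ, 0 < t → ∫ s in (0 : ℝ)..t, H s = c) : H =ᵐ[μ] 0 := by
  set K : ℝ → ℂ := (Set.Ioi 0).indicator H with hK
  have hKi : Integrable K := (integrable_indicator_iff measurableSet_Ioi).2 hH
  have hKH : ∀ t : ℝ, 0 < t → ∫ s in (0 : ℝ)..t, K s = c := fun t ht => by
    rw [← h t ht, intervalIntegral.integral_of_le ht.le, intervalIntegral.integral_of_le ht.le]
    exact setIntegral_congr_fun measurableSet_Ioc fun s hs => by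
      simp [hK, show (0 : ℝ) < s from hs.1]
  filter_upwards [ae_restrict_of_ae (LocallyIntegrable.ae_hasDerivAt_integral hKi.locallyIntegrable),
    ae_restrict_mem measurableSet_Ioi] with x hx hx0
  have hc : HasDerivAt (fun t => ∫ s in (0 : ℝ)..t, K s) 0 x := by
    refine (hasDerivAt_const x c).congr_of_eventuallyEq ?_
    filter_upwards [Ioi_mem_nhds hx0] with t ht using hKH t ht
  have := (hx 0).unique hc
  simpa [hK, Set.indicator, show (0 : ℝ) < x from hx0] using this

theorem ae_eq_zero_of_integral_primitive_min_eq_zero {p : ℝ → ℂ} (hp : Continuous p)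
    (hp0 : ∀ x, 0 < x → p x ≠ 0) {H : ℝ → ℂ} (hH : Integrable H μ) (γ : ℂ)
    (h : ∀ᵐ x ∂μ, ∫ y, (γ + ∫ t in (0 : ℝ)..min x y, p t) * H y ∂μ = 0) : H =ᵐ[μ] 0 := by
  set c := ∫ y, H y ∂μ
  -- Nothing is known about `H` on the negative axis; extension by zero makes its primitive
  -- continuous on all of `ℝ`.
  set K : ℝ → ℂ := (Set.Ioi 0).indicator H with hK
  have hKi : Integrable K := (integrable_indicator_iff measurableSet_Ioi).2 hH
  let q : ℝ → ℂ := fun t => p t * (c - ∫ s in (0 : ℝ)..t, K s)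
  have hq : Continuous q := hp.mul (continuous_const.sub
    (intervalIntegral.continuous_primitive (fun _ _ => hKi.intervalIntegrable) 0))
  have hKH : ∀ t : ℝ, 0 ≤ t → ∫ s in (0 : ℝ)..t, K s = ∫ s in (0 : ℝ)..t, H s := fun t ht => by
    rw [intervalIntegral.integral_of_le ht, intervalIntegral.integral_of_le ht]
    exact setIntegral_congr_fun measurableSet_Ioc fun s hs => by
      simp [hK, show (0 : ℝ) < s from hs.1]
  let P : ℝ → ℂ := fun x => γ * c + ∫ t in (0 : ℝ)..x, q t
  have hPd : ∀ x, HasDerivAt P (q x) x := fun x =>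
    (intervalIntegral.integral_hasDerivAt_right (hq.intervalIntegrable _ _)
      (hq.stronglyMeasurableAtFilter _ _) hq.continuousAt).const_add _
  have hP0 : P =ᵐ[μ] fun _ => 0 := by
    filter_upwards [h, ae_restrict_mem measurableSet_Ioi] with x hx hx0
    have hx0 : 0 < x := hx0
    have hint : Integrable (fun y => (∫ t in (0 : ℝ)..min x y, p t) * H y) μ := by
      have hcont : Continuous fun y => ∫ t in (0 : ℝ)..min x y, p t :=
        (intervalIntegral.continuous_primitive (fun _ _ => hp.intervalIntegrable _ _) 0).comp
          (continuous_const.min continuous_id)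
      obtain ⟨C, hC⟩ := (isCompact_Icc (a := (0 : ℝ)) (b := x)).exists_bound_of_continuousOn
        (f := fun y => ∫ t in (0 : ℝ)..y, p t) (intervalIntegral.continuous_primitive
          (fun _ _ => hp.intervalIntegrable _ _) 0).continuousOn
      refine hH.bdd_mul (c := C) hcont.aestronglyMeasurable ?_
      filter_upwards [ae_restrict_mem measurableSet_Ioi] with y hy
      exact hC _ ⟨le_min hx0.le (le_of_lt hy), min_le_left _ _⟩
    simp only [add_mul] at hx
    rw [integral_add (hH.const_mul γ) hint, integral_const_mul,
      integral_primitive_min_mul hp hH hx0] at hx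
    rw [← hx]
    simp only [P, q]
    congr 1
    refine intervalIntegral.integral_congr fun t ht => ?_
    rw [Set.uIcc_of_le hx0.le] at ht
    simp only [hKH t ht.1]
    rfl
  -- Continuity upgrades vanishing almost everywhere to vanishing everywhere, so `P` may be
  -- differentiated.
  have hP : Set.EqOn P (fun _ => 0) (Set.Ioi 0) :=
    Measure.eqOn_open_of_ae_eq hP0 isOpen_Ioi
      (fun x _ => (hPd x).continuousAt.continuousWithinAt) continuousOn_const
  refine ae_eq_zero_of_primitive_eq hH (c := c) fun t ht => ?_
  have hz : HasDerivAt P 0 t := by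
    refine (hasDerivAt_const t (0 : ℂ)).congr_of_eventuallyEq ?_
    filter_upwards [Ioi_mem_nhds ht] with s hs using hP hs
  have hqt : p t * (c - ∫ s in (0 : ℝ)..t, K s) = 0 := (hPd t).unique hz
  rw [← hKH t ht.le]
  exact (sub_eq_zero.1 ((mul_eq_zero.1 hqt).resolve_left (hp0 t ht))).symm

/-! ### Symmetric integral kernels and self-adjointness. -/

theorem IsKernelOf.congr {K K' : ℝ → ℝ → ℂ} {T : L2 →L[ℂ] L2} (hK : IsKernelOf K T)
    (h : ∀ x y, 0 < x → 0 < y → K x y = K' x y) : IsKernelOf K' T := by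
  intro f
  filter_upwards [hK f, ae_restrict_mem measurableSet_Ioi] with x hx hx0
  have e : (fun y => K x y * f y) =ᵐ[μ] fun y => K' x y * f y := by
    filter_upwards [ae_restrict_mem measurableSet_Ioi] with y hy
    rw [h x y hx0 hy]
  exact ⟨hx.1.congr e, hx.2.trans (integral_congr_ae e)⟩

/-- A bounded operator with a nonnegative symmetric measurable kernel is self-adjoint. -/
theorem IsKernelOf.isSelfAdjoint {K : ℝ → ℝ → ℂ} {T : L2 →L[ℂ] L2} (hK : IsKernelOf K T)
    (hmeas : Measurable (Function.uncurry K))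
    (hnonneg : ∀ x y, 0 < x → 0 < y → K x y = (‖K x y‖ : ℂ))
    (hsymm : ∀ x y, K x y = K y x) : IsSelfAdjoint T := by
  rw [ContinuousLinearMap.isSelfAdjoint_iff_isSymmetric]
  intro f g
  have hf := Lp.memLp f
  have hg := Lp.memLp g
  let F : ℝ → ℝ → ℂ := fun x y => g x * (K x y * starRingEnd ℂ (f y))
  -- Since `K ≥ 0`, `T |f|` is the integral of `|K f|`. It lies in `L²`, so pairing it with `g`
  -- gives the absolute convergence that Fubini needs.
  set n : L2 := hf.norm.ofReal.toLp _
  have hn : ⇑n =ᵐ[μ] fun y => ((‖f y‖ : ℝ) : ℂ) := MemLp.coeFn_toLp _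
  have hFm : AEStronglyMeasurable (Function.uncurry F) (μ.prod μ) :=
    (hg.1.comp_fst).mul (hmeas.aestronglyMeasurable.mul
      (Complex.continuous_conj.comp_aestronglyMeasurable hf.1.comp_snd))
  have hconj : ∀ x, 0 < x → ∀ y, 0 < y →
      starRingEnd ℂ (K x y * f y) = K x y * starRingEnd ℂ (f y) := fun x hx y hy => by
    rw [map_mul, hnonneg x y hx hy, Complex.conj_ofReal]
  have hF : Integrable (Function.uncurry F) (μ.prod μ) := by
    rw [integrable_prod_iff hFm]
    constructor
    · filter_upwards [hK f, ae_restrict_mem measurableSet_Ioi] with x hx hx0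
      change Integrable (fun y => g x * (K x y * starRingEnd ℂ (f y))) μ
      refine Integrable.const_mul ?_ _
      have := (Complex.conjLIE.toContinuousLinearEquiv : ℂ →L[ℝ] ℂ).integrable_comp hx.1
      refine this.congr ?_
      filter_upwards [ae_restrict_mem measurableSet_Ioi] with y hy
      exact hconj x hx0 y hy
    · have hi : Integrable (fun x => g x * T n x) μ := hg.integrable_mul (Lp.memLp (T n))
      refine hi.norm.congr ?_
      filter_upwards [hK n, ae_restrict_mem measurableSet_Ioi] with x hx hx0
      rw [hx.2]
      have e : ∫ y, K x y * n y ∂μ = ((∫ y, ‖K x y * starRingEnd ℂ (f y)‖ ∂μ : ℝ) : ℂ) := by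
        rw [← integral_complex_ofReal]
        refine integral_congr_ae ?_
        filter_upwards [hn, ae_restrict_mem measurableSet_Ioi] with y hy hy0
        rw [hy, hnonneg x y hx0 hy0]
        simp
      rw [e, norm_mul, Complex.norm_real, Real.norm_of_nonneg (integral_nonneg fun _ => norm_nonneg _),
        ← integral_const_mul]
      simp [F]
  have hleft : inner ℂ (T f) g = ∫ x, ∫ y, F x y ∂μ ∂μ := by
    rw [L2.inner_def]
    refine integral_congr_ae ?_
    filter_upwards [hK f, ae_restrict_mem measurableSet_Ioi] with x hx hx0
    simp only [F]
    rw [integral_const_mul, RCLike.inner_apply, hx.2, ← integral_conj]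
    congr 1
    refine integral_congr_ae ?_
    filter_upwards [ae_restrict_mem measurableSet_Ioi] with y hy
    exact hconj x hx0 y hy
  have hright : inner ℂ f (T g) = ∫ y, ∫ x, F x y ∂μ ∂μ := by
    rw [L2.inner_def]
    refine integral_congr_ae ?_
    filter_upwards [hK g] with y hy
    rw [RCLike.inner_apply, hy.2, ← integral_mul_const]
    refine integral_congr_ae (.of_forall fun x => ?_)
    simp only [F]
    rw [hsymm y x]
    ring
  exact hleft.trans ((integral_integral_swap hF).trans hright.symm)

/-! ### The Green functions and their operators. -/

theorem xi_eq (φ : ℝ → ℝ) (γ : ℂ) (x : ℝ) :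
    xi φ γ x = φ x * (γ + ∫ s in (0 : ℝ)..x, ((1 / φ s ^ 2 : ℝ) : ℂ)) := by
  rw [xi, psi, intervalIntegral.integral_ofReal]
  push_cast
  ring

theorem greenRobin_eq (φ : ℝ → ℝ) (γ : ℂ) (x y : ℝ) :
    greenRobin φ γ x y =
      φ x * ((γ + ∫ s in (0 : ℝ)..min x y, ((1 / φ s ^ 2 : ℝ) : ℂ)) * φ y) := by
  rw [greenRobin]
  split_ifs with h
  · rw [xi_eq, min_eq_left h]
    ring
  · rw [xi_eq, min_eq_right (le_of_not_ge h)]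
    ring

theorem greenRobin_eq_green_add (φ : ℝ → ℝ) (γ : ℂ) (x y : ℝ) :
    greenRobin φ γ x y = green φ x y + γ * φ x * φ y := by
  rw [greenRobin, green]
  split_ifs <;> simp only [xi] <;> ring

theorem greenRobin_zero (φ : ℝ → ℝ) : greenRobin φ 0 = green φ := by
  ext x y
  simp [greenRobin_eq_green_add]

theorem green_symm (φ : ℝ → ℝ) (x y : ℝ) : green φ x y = green φ y x := by
  rw [← greenRobin_zero, greenRobin_eq, greenRobin_eq, min_comm]
  ring

/-- Allows `φ` to be altered on the negative axis, where it need be neither continuous nor positive.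
-/
theorem greenRobin_congr {φ φ' : ℝ → ℝ} (h : ∀ x, 0 ≤ x → φ x = φ' x) (γ : ℂ) {x y : ℝ}
    (hx : 0 ≤ x) (hy : 0 ≤ y) : greenRobin φ γ x y = greenRobin φ' γ x y := by
  rw [greenRobin_eq, greenRobin_eq, h x hx, h y hy]
  have e : ∫ s in (0 : ℝ)..min x y, ((1 / φ s ^ 2 : ℝ) : ℂ) =
      ∫ s in (0 : ℝ)..min x y, ((1 / φ' s ^ 2 : ℝ) : ℂ) := by
    refine intervalIntegral.integral_congr fun s hs => ?_
    rw [Set.uIcc_of_le (le_min hx hy)] at hs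
    simp only [h s hs.1]
  rw [e]

theorem psi_nonneg {φ : ℝ → ℝ} (hφ : ∀ x, 0 < φ x) {x : ℝ} (hx : 0 ≤ x) : 0 ≤ psi φ x :=
  mul_nonneg (hφ x).le (intervalIntegral.integral_nonneg hx fun s _ => by positivity)

theorem green_eq_norm {φ : ℝ → ℝ} (hφ : ∀ x, 0 < φ x) {x y : ℝ} (hx : 0 ≤ x) (hy : 0 ≤ y) :
    green φ x y = (‖green φ x y‖ : ℂ) := by
  rw [green]
  split_ifs
  all_goals
    rw [← Complex.ofReal_mul, Complex.norm_real, Real.norm_of_nonneg]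
    exact mul_nonneg (by first | exact psi_nonneg hφ hx | exact (hφ _).le)
      (by first | exact psi_nonneg hφ hy | exact (hφ _).le)

theorem continuous_one_div_sq {φ : ℝ → ℝ} (hc : Continuous φ) (hφ : ∀ x, 0 < φ x) :
    Continuous fun s => 1 / φ s ^ 2 :=
  continuous_const.div (hc.pow 2) fun s => (pow_pos (hφ s) 2).ne'

theorem measurable_green {φ : ℝ → ℝ} (hc : Continuous φ) (hφ : ∀ x, 0 < φ x) :
    Measurable (Function.uncurry (green φ)) := by
  have hψ : Continuous (psi φ) := hc.mul (intervalIntegral.continuous_primitive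
    (fun _ _ => (continuous_one_div_sq hc hφ).intervalIntegrable _ _) 0)
  exact Measurable.ite (measurableSet_le measurable_fst measurable_snd)
    (by fun_prop) (by fun_prop)

theorem IsKernelOf.eq_zero_of_greenRobin {φ : ℝ → ℝ} (hc : Continuous φ) (hφ : ∀ x, 0 < φ x)
    (hL : MemLp φ 2 μ) {γ : ℂ} {T : L2 →L[ℂ] L2} (hT : IsKernelOf (greenRobin φ γ) T) {f : L2}
    (hf : T f = 0) : f = 0 := by
  have hH : Integrable (fun y => (φ y : ℂ) * f y) μ :=
    (hL.ofReal (K := ℂ)).integrable_mul (Lp.memLp f)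
  have key := ae_eq_zero_of_integral_primitive_min_eq_zero
    (p := fun s => ((1 / φ s ^ 2 : ℝ) : ℂ))
    (Complex.continuous_ofReal.comp (continuous_one_div_sq hc hφ))
    (fun x _ => Complex.ofReal_ne_zero.2 (one_div_pos.2 (pow_pos (hφ x) 2)).ne') hH γ ?_
  · rw [Lp.eq_zero_iff_ae_eq_zero]
    filter_upwards [key] with y hy
    exact (mul_eq_zero.1 hy).resolve_left (Complex.ofReal_ne_zero.2 (hφ y).ne')
  · filter_upwards [hT f, (Lp.eq_zero_iff_ae_eq_zero).1 hf] with x hx hx0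
    have h1 := hx.2
    simp only [greenRobin_eq, mul_assoc] at h1
    rw [hx0, integral_const_mul] at h1
    exact (mul_eq_zero.1 h1.symm).resolve_left (Complex.ofReal_ne_zero.2 (hφ x).ne')

/-- Adding a multiple of `φ x φ y` to the kernel adds a multiple of `|φ⟩⟨φ|` to the operator. -/
theorem IsKernelOf.greenRobin_add_rankOne {φ : ℝ → ℝ} (hL : MemLp φ 2 μ) {G : L2 →L[ℂ] L2}
    (hG : IsKernelOf (green φ) G) (γ : ℂ) :
    IsKernelOf (greenRobin φ γ) (G + γ • InnerProductSpace.rankOne ℂ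
      ((hL.ofReal (K := ℂ)).toLp _) ((hL.ofReal (K := ℂ)).toLp _)) := by
  intro f
  set v : L2 := (hL.ofReal (K := ℂ)).toLp _ with hv
  have hvφ : ⇑v =ᵐ[μ] fun y => (φ y : ℂ) := MemLp.coeFn_toLp _
  have hH : Integrable (fun y => (φ y : ℂ) * f y) μ :=
    (hL.ofReal (K := ℂ)).integrable_mul (Lp.memLp f)
  have hin : inner ℂ v f = ∫ y, (φ y : ℂ) * f y ∂μ := by
    rw [L2.inner_def]
    refine integral_congr_ae ?_
    filter_upwards [hvφ] with y hy
    rw [RCLike.inner_apply, hy, Complex.conj_ofReal, mul_comm]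
  have happ : (G + γ • InnerProductSpace.rankOne ℂ v v) f = G f + (γ * inner ℂ v f) • v := by
    simp [mul_smul]
  rw [happ]
  filter_upwards [hG f, hvφ, Lp.coeFn_add (G f) ((γ * inner ℂ v f) • v),
    Lp.coeFn_smul (γ * inner ℂ v f) v] with x hx hvx hadd hsmul
  have e : (fun y => greenRobin φ γ x y * f y) =
      fun y => green φ x y * f y + γ * φ x * (φ y * f y) := by
    ext y
    rw [greenRobin_eq_green_add]
    ring
  rw [e]
  refine ⟨hx.1.add (hH.const_mul _), ?_⟩
  rw [integral_add hx.1 (hH.const_mul _), integral_const_mul, hadd, Pi.add_apply, hsmul,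
    Pi.smul_apply, hvx, hin, hx.2, smul_eq_mul]
  ring

end HalfLine

theorem theorem5p1 (φ : ℝ → ℝ)
    (hφW : HalfLine.MemW φ)
    (hφpos : ∀ x : ℝ, 0 ≤ x → 0 < φ x)
    (hφL2 : MeasureTheory.MemLp φ 2 HalfLine.μ)
    (G : HalfLine.L2 →L[ℂ] HalfLine.L2)
    (hG : HalfLine.IsKernelOf (HalfLine.green φ) G) :
    ∃ Gγ : ℂ → (HalfLine.L2 →L[ℂ] HalfLine.L2),
      (∀ γ : ℂ, γ ≠ 0 →
        HalfLine.IsKernelOf (HalfLine.greenRobin φ γ) (Gγ γ) ∧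
        Gγ γ = G + γ • InnerProductSpace.rankOne ℂ
          ((hφL2.ofReal (K := ℂ)).toLp _) ((hφL2.ofReal (K := ℂ)).toLp _) ∧
        (∀ f : HalfLine.L2, Gγ γ f = 0 → f = 0) ∧
        DenseRange (Gγ γ) ∧
        (HalfLine.inverseOp (Gγ γ)).IsClosed ∧
        Dense ((HalfLine.inverseOp (Gγ γ)).domain : Set HalfLine.L2) ∧
        (0 : ℂ) ∉ HalfLine.spec (HalfLine.inverseOp (Gγ γ))) ∧
      (∀ γ γ' : ℂ, γ ≠ 0 → γ' ≠ 0 →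
        HalfLine.essSpec (HalfLine.inverseOp (Gγ γ)) =
          HalfLine.essSpec (HalfLine.inverseOp (Gγ γ'))) ∧
      (∀ γ : ℝ, γ ≠ 0 → IsSelfAdjoint (HalfLine.inverseOp (Gγ (γ : ℂ)))) := by
  set v : HalfLine.L2 := (hφL2.ofReal (K := ℂ)).toLp _
  set R : HalfLine.L2 →L[ℂ] HalfLine.L2 := InnerProductSpace.rankOne ℂ v v
  -- `φ` agrees on the half-line with a function that is continuous and positive on `ℝ`
  let Φ : ℝ → ℝ := fun x => φ (max x 0)
  have hΦφ : ∀ x, 0 ≤ x → φ x = Φ x := fun x hx => by simp only [Φ, max_eq_left hx]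
  have hΦc : Continuous Φ := hφW.1.comp_continuous (by fun_prop) fun x => le_max_right x 0
  have hΦpos : ∀ x, 0 < Φ x := fun x => hφpos _ (le_max_right x 0)
  have hΦL2 : MemLp Φ 2 HalfLine.μ := hφL2.ae_eq (by
    filter_upwards [ae_restrict_mem measurableSet_Ioi] with x hx using hΦφ x (le_of_lt hx))
  have hker : ∀ γ : ℂ, HalfLine.IsKernelOf (HalfLine.greenRobin φ γ) (G + γ • R) :=
    hG.greenRobin_add_rankOne hφL2
  have hkerΦ : ∀ γ : ℂ, HalfLine.IsKernelOf (HalfLine.greenRobin Φ γ) (G + γ • R) := fun γ =>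
    (hker γ).congr fun x y hx hy => HalfLine.greenRobin_congr hΦφ γ hx.le hy.le
  have hinj : ∀ (γ : ℂ) (f : HalfLine.L2), (G + γ • R) f = 0 → f = 0 := fun γ f =>
    (hkerΦ γ).eq_zero_of_greenRobin hΦc hΦpos hΦL2
  have hGsa : IsSelfAdjoint G := by
    -- The value `γ = 0` recovers `G`, now with the kernel built from `Φ`.
    have h0 := hkerΦ 0
    rw [zero_smul, add_zero, HalfLine.greenRobin_zero] at h0
    exact h0.isSelfAdjoint (HalfLine.measurable_green hΦc hΦpos)
      (fun x y hx hy => HalfLine.green_eq_norm hΦpos hx.le hy.le) (HalfLine.green_symm Φ)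
  have hadj : ∀ γ : ℂ, ContinuousLinearMap.adjoint (G + γ • R) = G + starRingEnd ℂ γ • R :=
    fun γ => by
      rw [map_add, map_smulₛₗ, hGsa.adjoint_eq, InnerProductSpace.adjoint_rankOne]
  -- The adjoint lies in the same family, at `conj γ`, so `hinj` applies to it.
  have hdense : ∀ γ : ℂ, DenseRange (G + γ • R) := fun γ =>
    HalfLine.denseRange_of_adjoint_injective (hadj γ ▸ hinj _)
  refine ⟨fun γ => G + γ • R, fun γ _ => ⟨hker γ, rfl, hinj γ, hdense γ,
    HalfLine.isClosed_inverseOp (hinj γ), HalfLine.dense_domain_inverseOp (hinj γ) (hdense γ),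
    HalfLine.zero_notMem_spec_inverseOp (hinj γ)⟩, fun γ γ' _ _ => ?_, fun γ _ => ?_⟩
  · refine HalfLine.essSpec_inverseOp_eq (hinj γ) (hinj γ') ?_
    have hR : (R : HalfLine.L2 →ₗ[ℂ] HalfLine.L2).HasFiniteRange := by
      refine Submodule.FG.of_le (Submodule.fg_span_singleton v) ?_
      rintro _ ⟨f, rfl⟩
      exact Submodule.mem_span_singleton.2 ⟨inner ℂ v f, rfl⟩
    have e : ((G + γ • R : HalfLine.L2 →L[ℂ] HalfLine.L2) : HalfLine.L2 →ₗ[ℂ] HalfLine.L2) -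
        ((G + γ' • R : HalfLine.L2 →L[ℂ] HalfLine.L2) : HalfLine.L2 →ₗ[ℂ] HalfLine.L2) =
        (γ - γ') • (R : HalfLine.L2 →ₗ[ℂ] HalfLine.L2) := by
      ext1 f
      simp [sub_smul]
    exact e ▸ hR.smul _
  · refine HalfLine.isSelfAdjoint_inverseOp (hinj γ) (hdense γ) ?_
    rw [ContinuousLinearMap.isSelfAdjoint_iff', hadj, Complex.conj_ofReal]
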